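/- Let $X$ be a nontrivial real Banach space with closed unit ball $B_X$. A slice of $B_X$ is a set of the form $S(B_X,x^*,\alpha)=\{x\in B_X : x^*(x)>1-\alpha\}$ with $x^*\in X^*$, $\|x^*\|=1$ and $\alpha>0$. The space $X$ has the symmetric strong diameter 2 property (SSD2P) if for every finite family $S_1,\dots,S_n$ of slices of $B_X$ and every $\varepsilon>0$ there exist $x_i\in S_i$ ($i=1,\dots,n$) and a single $y\in B_X$, independent of $i$, such that $x_i+y\in S_i$ and $x_i-y\in S_i$ for every $i$, and $\|y\|>1-\varepsilon$. If the bidual $X^{**}$ has the SSD2P, then $X$ has the SSD2P. -/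

import Mathlib

/-- The slice `S(B_X, f, α) = {x ∈ B_X : f x > 1 - α}` of the closed unit ball `B_X`. -/
def ballSlice {X : Type*} [NormedAddCommGroup X] [NormedSpace ℝ X]
    (f : StrongDual ℝ X) (α : ℝ) : Set X :=
  {x | x ∈ Metric.closedBall (0 : X) 1 ∧ 1 - α < f x}

/-- `S` is a slice of the closed unit ball of `X`: it is `S(B_X, f, α)` for some norm-one
functional `f` and some `α > 0`. -/
def IsBallSlice {X : Type*} [NormedAddCommGroup X] [NormedSpace ℝ X] (S : Set X) : Prop :=
  ∃ f : StrongDual ℝ X, ∃ α : ℝ, ‖f‖ = 1 ∧ 0 < α ∧ S = ballSlice f α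

/-- The symmetric strong diameter 2 property of a real normed space: for every finite family of
slices of the unit ball and every `ε > 0` there are points `x i` of the slices and a single `y` in
the unit ball, of norm greater than `1 - ε`, such that `x i + y` and `x i - y` stay in the
`i`-th slice. -/
def SSD2P (X : Type*) [NormedAddCommGroup X] [NormedSpace ℝ X] : Prop :=
  ∀ (n : ℕ) (S : Fin n → Set X), (∀ i, IsBallSlice (S i)) → ∀ ε : ℝ, 0 < ε →
    ∃ (x : Fin n → X) (y : X), y ∈ Metric.closedBall (0 : X) 1 ∧
      (∀ i, x i ∈ S i ∧ x i + y ∈ S i ∧ x i - y ∈ S i) ∧ 1 - ε < ‖y‖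

/-!
The property passes from `X**` to `X` because it only involves finitely many norm inequalities and
finitely many strict inequalities for functionals in `X*`. Given slices of `B_X` defined by
functionals `f i`, the same functionals define slices of the ball of `X**`; there one finds `x i`,
`y` in `X**`. The points `x i + y`, `x i - y`, `y` form an element of the unit ball of the finite
power `(X**)^κ` that lies in the weak-star closure of a subspace `M` of `X^κ`, where
`M` consists of all families of this shape. A Goldstine-type argument
(`exists_mem_lt_apply_of_annihilator`) replaces it by an element of the unit ball of `M` satisfying
the same strict inequalities: otherwise a functional separates, in `ℝ^κ`, the image of the unit
ball of `M` from the target, and a norm-preserving extension of this functional from `M` to `X^κ`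
contradicts the norm bound in `X**`. The lower bound on the norm of `y` is one of these
inequalities, for a functional that nearly norms `y`.
-/

theorem exists_norm_le_one_lt_apply {E : Type*} [NormedAddCommGroup E] [NormedSpace ℝ E]
    (f : StrongDual ℝ E) {r : ℝ} (hr : r < ‖f‖) : ∃ z : E, ‖z‖ ≤ 1 ∧ r < f z := by
  obtain ⟨z, hz, hlt⟩ := f.exists_lt_apply_of_lt_opNorm hr
  rcases abs_cases (f z) with ⟨h, _⟩ | ⟨h, _⟩
  · exact ⟨z, hz.le, by rwa [Real.norm_eq_abs, h] at hlt⟩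
  · exact ⟨-z, by rw [norm_neg]; exact hz.le, by rwa [Real.norm_eq_abs, h, ← map_neg] at hlt⟩

/-- The norms of the components of a functional on a finite power with the supremum norm add up to
at most the norm of the functional; here tested against functionals on the dual of norm at most
one. -/
theorem sum_apply_comp_single_le {κ X : Type*} [Fintype κ] [DecidableEq κ]
    [NormedAddCommGroup X] [NormedSpace ℝ X] (Φ : StrongDual ℝ (κ → X))
    (w : κ → StrongDual ℝ (StrongDual ℝ X)) (hw : ∀ k, ‖w k‖ ≤ 1) :
    ∑ k, w k (Φ.comp (ContinuousLinearMap.single ℝ (fun _ => X) k)) ≤ ‖Φ‖ := by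
  set φ : κ → StrongDual ℝ X := fun k => Φ.comp (ContinuousLinearMap.single ℝ (fun _ => X) k)
  have hle : ∀ k, w k (φ k) ≤ ‖φ k‖ := fun k =>
    (le_abs_self _).trans (((w k).le_opNorm (φ k)).trans
      (mul_le_of_le_one_left (norm_nonneg _) (hw k)))
  refine (Finset.sum_le_sum fun k _ => hle k).trans ?_
  refine le_of_forall_pos_lt_add fun η hη => ?_
  -- Each component is almost normed at a point of the unit ball; distribute the error over `κ`.
  set δ := η / (Fintype.card κ + 1) with hδ
  have hδ0 : 0 < δ := by positivity
  have hex : ∀ k, ∃ z : X, ‖z‖ ≤ 1 ∧ ‖φ k‖ - δ < φ k z := fun k =>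
    exists_norm_le_one_lt_apply _ (sub_lt_self _ hδ0)
  choose z hz hlt using hex
  have hsum : ∑ k, φ k (z k) = Φ z := by
    simp only [φ, ContinuousLinearMap.comp_apply, ContinuousLinearMap.single_apply, ← map_sum]
    rw [Finset.univ_sum_single]
  have hΦ : Φ z ≤ ‖Φ‖ := (le_abs_self _).trans <| (Φ.le_opNorm z).trans <|
    mul_le_of_le_one_right (norm_nonneg _) ((pi_norm_le_iff_of_nonneg zero_le_one).2 hz)
  have h1 : ∑ k, ‖φ k‖ ≤ ∑ k, (φ k (z k) + δ) :=
    Finset.sum_le_sum fun k _ => by linarith [hlt k]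
  rw [Finset.sum_add_distrib, hsum, Finset.sum_const, nsmul_eq_mul, Finset.card_univ] at h1
  have h2 : (Fintype.card κ : ℝ) * δ < η := by
    have : (Fintype.card κ + 1 : ℝ) * δ = η := by rw [hδ]; field_simp
    linarith
  linarith

/-- A Goldstine theorem for subspaces of finite powers: let `w` be a family in the unit ball of
`X**` which is annihilated by every family of functionals annihilating the subspace `M` of
`κ → X`. Then finitely many strict lower bounds satisfied by `w` are satisfied by an element of
the unit ball of `M`. -/
theorem exists_mem_lt_apply_of_annihilator {κ X : Type*} [Fintype κ]
    [NormedAddCommGroup X] [NormedSpace ℝ X] (M : Submodule ℝ (κ → X))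
    (w : κ → StrongDual ℝ (StrongDual ℝ X)) (hw : ∀ k, ‖w k‖ ≤ 1)
    (hM : ∀ φ : κ → StrongDual ℝ X, (∀ m ∈ M, ∑ k, φ k (m k) = 0) → ∑ k, w k (φ k) = 0)
    (g : κ → StrongDual ℝ X) (r : κ → ℝ) (hr : ∀ k, r k < w k (g k)) :
    ∃ m ∈ M, (∀ k, ‖m k‖ ≤ 1) ∧ ∀ k, r k < g k (m k) := by
  classical
  let T : (κ → X) →ₗ[ℝ] (κ → ℝ) := LinearMap.pi fun k => (g k).toLinearMap ∘ₗ LinearMap.proj k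
  set C : Set (κ → ℝ) := T '' ((M : Set (κ → X)) ∩ Metric.closedBall 0 1)
  by_cases ht : (fun k => w k (g k)) ∈ closure C
  · have hopen : IsOpen {s : κ → ℝ | ∀ k, r k < s k} := by
      simp only [Set.ofPred_forall]
      exact isOpen_iInter_of_finite fun k => isOpen_lt continuous_const (continuous_apply k)
    obtain ⟨_, hs, m, ⟨hmM, hm⟩, rfl⟩ := mem_closure_iff.1 ht _ hopen hr
    exact ⟨m, hmM, (pi_norm_le_iff_of_nonneg zero_le_one).1 (mem_closedBall_zero_iff.1 hm), hs⟩
  exfalso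
  have hconv : Convex ℝ (closure C) :=
    ((M.convex.inter (convex_closedBall 0 1)).linear_image T).closure
  obtain ⟨c, s, hcs, hst⟩ := geometric_hahn_banach_closed_point hconv isClosed_closure ht
  have hc : ∀ a : κ → ℝ, c a = ∑ k, c (Pi.single k 1) * a k := by
    intro a
    conv_lhs => rw [← Finset.univ_sum_single a, map_sum]
    refine Finset.sum_congr rfl fun k _ => ?_
    rw [show Pi.single k (a k) = a k • (Pi.single k 1 : κ → ℝ) by
      rw [← Pi.single_smul, smul_eq_mul, mul_one], map_smul, smul_eq_mul, mul_comm]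
  let Ψ : StrongDual ℝ (κ → X) :=
    ∑ k, c (Pi.single k 1) • (g k).comp (ContinuousLinearMap.proj k)
  have hΨ : ∀ m, Ψ m = ∑ k, c (Pi.single k 1) * g k (m k) := by
    intro m; simp [Ψ]
  have hΨT : ∀ m, Ψ m = c (T m) := by
    intro m; rw [hΨ, hc]; rfl
  have hball : ∀ m ∈ M, ‖m‖ ≤ 1 → Ψ m < s := fun m hm h1 => by
    rw [hΨT]
    exact hcs _ (subset_closure ⟨m, ⟨hm, mem_closedBall_zero_iff.2 h1⟩, rfl⟩)
  have hnorm : ‖Ψ.comp M.subtypeL‖ ≤ s := by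
    refine le_of_forall_lt fun b hb => ?_
    obtain ⟨z, hz, hlt⟩ := ContinuousLinearMap.exists_lt_apply_of_lt_opNorm _ hb
    refine hlt.trans (abs_lt.2 ⟨?_, hball z z.2 hz.le⟩)
    have := hball (-z) (M.neg_mem z.2) (by rw [norm_neg]; exact hz.le)
    rw [map_neg] at this
    exact neg_lt.1 this
  obtain ⟨Φ, hΦ, hΦn⟩ := exists_extension_norm_eq M (Ψ.comp M.subtypeL)
  set φ : κ → StrongDual ℝ X := fun k => Φ.comp (ContinuousLinearMap.single ℝ (fun _ => X) k)
  -- The components of the extension and of `Ψ` differ by a family annihilating `M`.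
  have hzero := hM (fun k => φ k - c (Pi.single k 1) • g k) (by
    intro m hm
    have h1 : ∑ k, φ k (m k) = Φ m := by
      simp only [φ, ContinuousLinearMap.comp_apply, ContinuousLinearMap.single_apply, ← map_sum]
      rw [Finset.univ_sum_single]
    have h2 : Φ m = Ψ m := hΦ ⟨m, hm⟩
    simp only [sub_apply, smul_apply, smul_eq_mul,
      Finset.sum_sub_distrib, h1, h2, hΨ, sub_self])
  have hval : ∑ k, w k (φ k) = c fun k => w k (g k) := by
    rw [hc, ← sub_eq_zero, ← Finset.sum_sub_distrib, ← hzero]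
    simp
  have := sum_apply_comp_single_le Φ w hw
  linarith

/-- The families `(y, (x i + y) i, (x i - y) i)` in `X`: they are characterised by
`(x i + y) - (x i - y) = 2 • y`. -/
def symmetricFamilies (ι X : Type*) [NormedAddCommGroup X] [NormedSpace ℝ X] :
    Submodule ℝ (Option (ι ⊕ ι) → X) where
  carrier := {u | ∀ i, u (some (.inl i)) - u (some (.inr i)) = (2 : ℝ) • u none}
  add_mem' {u v} hu hv i := by
    simp only [Pi.add_apply, smul_add, ← hu i, ← hv i]; abel
  zero_mem' i := by simp
  smul_mem' a u hu i := by
    simp only [Pi.smul_apply, ← smul_sub, hu i, smul_comm a]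

/-- The family `(y, (x i + y) i, (x i - y) i)`. The coordinate `y` is kept because its norm has
to be controlled also when `ι` is empty, and to impose a lower bound on a functional at `y`. -/
def symmetricFamily {ι X : Type*} [NormedAddCommGroup X] (x : ι → X) (y : X) :
    Option (ι ⊕ ι) → X
  | none => y
  | some (.inl i) => x i + y
  | some (.inr i) => x i - y

theorem symmetricFamily_mem {ι X : Type*} [NormedAddCommGroup X] [NormedSpace ℝ X]
    (x : ι → X) (y : X) : symmetricFamily x y ∈ symmetricFamilies ι X := fun i => by
  simp only [symmetricFamily, two_smul]; abel

theorem norm_symmetricFamily_le {ι X : Type*} [NormedAddCommGroup X] {x : ι → X} {y : X} {C : ℝ}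
    (hy : ‖y‖ ≤ C) (hadd : ∀ i, ‖x i + y‖ ≤ C) (hsub : ∀ i, ‖x i - y‖ ≤ C) :
    ∀ k, ‖symmetricFamily x y k‖ ≤ C
  | none => hy
  | some (.inl i) => hadd i
  | some (.inr i) => hsub i

/-- Symmetric families in `X**` are annihilated by the functionals that annihilate all symmetric
families in `X`. -/
theorem sum_symmetricFamily_apply_eq_zero {ι X : Type*} [Fintype ι]
    [NormedAddCommGroup X] [NormedSpace ℝ X] (x : ι → StrongDual ℝ (StrongDual ℝ X))
    (y : StrongDual ℝ (StrongDual ℝ X)) (φ : Option (ι ⊕ ι) → StrongDual ℝ X)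
    (hφ : ∀ m ∈ symmetricFamilies ι X, ∑ k, φ k (m k) = 0) :
    ∑ k, symmetricFamily x y k (φ k) = 0 := by
  classical
  have hadd : ∀ i, φ (some (.inl i)) + φ (some (.inr i)) = 0 := by
    intro i
    ext z
    have := hφ _ (symmetricFamily_mem (Pi.single i z) 0)
    simp only [Fintype.sum_option, Fintype.sum_sum_type, symmetricFamily, map_zero, zero_add,
      add_zero, sub_zero, ← Finset.sum_add_distrib] at this
    rw [Finset.sum_eq_single i (fun j _ hj => by simp [hj]) (by simp)] at this
    simpa using this
  have hsub : φ none + ∑ i, (φ (some (.inl i)) - φ (some (.inr i))) = 0 := by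
    ext z
    have := hφ _ (symmetricFamily_mem 0 z)
    simp only [Fintype.sum_option, Fintype.sum_sum_type, symmetricFamily, Pi.zero_apply, zero_add,
      zero_sub, map_neg, Finset.sum_neg_distrib] at this
    simp only [add_apply, sum_apply,
      sub_apply, Finset.sum_sub_distrib, zero_apply]
    linarith
  have hx : ∀ i, x i (φ (some (.inl i))) + x i (φ (some (.inr i))) = 0 := fun i => by
    rw [← map_add, hadd, map_zero]
  have hy := congrArg y hsub
  simp only [map_add, map_sum, map_sub, map_zero] at hy
  simp only [Fintype.sum_option, Fintype.sum_sum_type, symmetricFamily,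
    add_apply, sub_apply]
  rw [← Finset.sum_add_distrib, ← hy]
  congr 1
  exact Finset.sum_congr rfl fun i _ => by linarith [hx i]

/-- The SSD2P in terms of norms of symmetric families. The points `x i` need no condition of their
own: they are midpoints of `x i + y` and `x i - y`. -/
theorem SSD2P.exists_norm_symmetricFamily_le {Z : Type*} [NormedAddCommGroup Z] [NormedSpace ℝ Z]
    (h : SSD2P Z) {n : ℕ} {f : Fin n → StrongDual ℝ Z} {α : Fin n → ℝ} (hf : ∀ i, ‖f i‖ = 1)
    (hα : ∀ i, 0 < α i) {ε : ℝ} (hε : 0 < ε) :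
    ∃ (x : Fin n → Z) (y : Z), (∀ k, ‖symmetricFamily x y k‖ ≤ 1) ∧
      (∀ i, 1 - α i < f i (x i + y) ∧ 1 - α i < f i (x i - y)) ∧ 1 - ε < ‖y‖ := by
  obtain ⟨x, y, hy, hxy, hyε⟩ :=
    h n (fun i => ballSlice (f i) (α i)) (fun i => ⟨f i, α i, hf i, hα i, rfl⟩) ε hε
  exact ⟨x, y, norm_symmetricFamily_le (mem_closedBall_zero_iff.1 hy)
    (fun i => mem_closedBall_zero_iff.1 (hxy i).2.1.1)
    (fun i => mem_closedBall_zero_iff.1 (hxy i).2.2.1),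
    fun i => ⟨(hxy i).2.1.2, (hxy i).2.2.2⟩, hyε⟩

theorem corollary4p2 (X : Type*) [NormedAddCommGroup X] [NormedSpace ℝ X] [CompleteSpace X]
    [Nontrivial X] (h : SSD2P (StrongDual ℝ (StrongDual ℝ X))) : SSD2P X := by
  intro n S hS ε hε
  choose f α hf hα hSf using hS
  obtain ⟨x, y, hw, hxy, hyε⟩ := h.exists_norm_symmetricFamily_le
    (f := fun i => NormedSpace.inclusionInDoubleDual ℝ (StrongDual ℝ X) (f i))
    (fun i => ((NormedSpace.inclusionInDoubleDualLi ℝ).norm_map (f i)).trans (hf i)) hα hε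
  obtain ⟨g, hg, hgy⟩ := exists_norm_le_one_lt_apply y hyε
  obtain ⟨m, hmM, hm1, hmr⟩ := exists_mem_lt_apply_of_annihilator (symmetricFamilies (Fin n) X)
    (symmetricFamily x y) hw (sum_symmetricFamily_apply_eq_zero x y)
    (fun k => k.elim g (Sum.elim f f))
    (fun k => k.elim (1 - ε) (Sum.elim (fun i => 1 - α i) fun i => 1 - α i)) (by
      rintro (_ | i | i)
      · exact hgy
      · exact (hxy i).1
      · exact (hxy i).2)
  have hadd : ∀ i, m (some (.inr i)) + m none + m none = m (some (.inl i)) := fun i => by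
    rw [add_assoc, ← two_smul ℝ (m none), ← hmM i]; abel
  have hplus : ∀ i, m (some (.inl i)) ∈ ballSlice (f i) (α i) := fun i =>
    ⟨mem_closedBall_zero_iff.2 (hm1 _), hmr (some (.inl i))⟩
  have hminus : ∀ i, m (some (.inr i)) ∈ ballSlice (f i) (α i) := fun i =>
    ⟨mem_closedBall_zero_iff.2 (hm1 _), hmr (some (.inr i))⟩
  have hconv : ∀ i, Convex ℝ (ballSlice (f i) (α i)) := fun i =>
    (convex_closedBall 0 1).inter (convex_halfSpace_gt (f i).toLinearMap.isLinear _)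
  refine ⟨fun i => m (some (.inr i)) + m none, m none, mem_closedBall_zero_iff.2 (hm1 _),
    fun i => ?_, ?_⟩
  · rw [hSf i]
    refine ⟨?_, ?_, ?_⟩
    · -- The centre is the midpoint of the two extreme points, and slices are convex.
      have := hconv i (hminus i) (hplus i) (a := 1 / 2) (b := 1 / 2)
        (by norm_num) (by norm_num) (by norm_num)
      convert this using 1
      rw [← hadd i]
      module
    · rw [hadd]; exact hplus i
    · rw [add_sub_cancel_right]; exact hminus i
  · have hgm : 1 - ε < g (m none) := hmr none
    exact hgm.trans_le <| (le_abs_self _).trans <| (g.le_opNorm _).trans <|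
      mul_le_of_le_one_left (norm_nonneg _) hg
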